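/- **Theorem 3.1.** A *Lévy measure* is a (non-negative Borel) measure $G$ on $[0,\infty)$ with $\int_{[0,\infty)}(1\wedge y^{-1})\,G(dy)<\infty$. An *extended Lévy measure* is a pair $(G,g_\infty)$, abbreviated $G$, consisting of a Lévy measure $G$ and a number $g_\infty\ge 0$, called the charge of $y^{-1}G(dy)$ at $\infty$. Integrals of $y^{-1}G(dy)$ over sets containing $\infty$ include this charge: $\int_{[x,\infty]}y^{-1}G(dy)=\int_{[x,\infty)}y^{-1}G(dy)+g_\infty$ for $x>0$. A sequence $G^{(n)}$ of extended Lévy measures *converges* to an extended Lévy measure $G$ if, at every point $x\in(0,\infty)$ of continuity of $x\mapsto\int_{[0,x]}G(dy)$, $$\int_{[0,x]}G^{(n)}(dy)\to\int_{[0,x]}G(dy)\quad\text{and}\quad\int_{[x,\infty]}y^{-1}G^{(n)}(dy)\to\int_{[x,\infty]}y^{-1}G(dy)\qquad(n\to\infty).$$ The first- and second-order Laplace exponents of $G$ are, for $\operatorname{Re}q>0$ and with $g_0=G(\{0\})$, $$\Phi(q)=q\,g_0+g_\infty+\int_{(0,\infty)}\frac{1-e^{-qx}}{x}\,G(dx),\qquad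 \Psi(q)=\tfrac12q^2g_0+q\,g_\infty+\int_{(0,\infty)}\frac{e^{-qx}-1+qx}{x^2}\,G(dx).$$ Let $G^{(n)}$ be a sequence of extended Lévy measures with Laplace exponents $\Phi^{(n)}$ and $\Psi^{(n)}$. Then, taking $n\to\infty$, the following are equivalent: - (i) $G^{(n)}$ converges to some extended Lévy measure $G$; - (ii) $\lim_{n\to\infty}\Phi^{(n)}(q)$ exists (and is finite) for each real $q>0$; - (iii) $\lim_{n\to\infty}\Psi^{(n)}(q)$ exists (and is finite) for each real $q>0$. Moreover, whenever $G^{(n)}$ converges to an extended Lévy measure $G$ with Laplace exponents $\Phi$ and $\Psi$, one has $\Phi^{(n)}(q)\to\Phi(q)$ and $\Psi^{(n)}(q)\to\Psi(q)$ for every real $q>0$. -/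

import Mathlib

open Filter Topology MeasureTheory Set
open scoped NNReal ENNReal

noncomputable section

/-- A Lévy measure: a measure `G` on `[0, ∞)` with `∫ (1 ∧ y⁻¹) G(dy) < ∞`.
The inverse is taken in `[0, ∞]`, so the integrand equals `1` at `y = 0`. -/
def IsLevyMeasure (G : Measure ℝ≥0) : Prop :=
  ∫⁻ y : ℝ≥0, min 1 (y : ℝ≥0∞)⁻¹ ∂G < ∞

/-- An extended Lévy measure on `[0, ∞]`: a pair `(G, g_∞)` of a Lévy measure `G` on `[0, ∞)`
and a number `g_∞ ≥ 0`, the charge of `y⁻¹ G(dy)` at `∞`. -/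
structure ExtLevyMeasure where
  /-- the Lévy measure `G` on `[0, ∞)` -/
  toMeasure : Measure ℝ≥0
  /-- the charge `g_∞` of `y⁻¹ G(dy)` at `∞` -/
  charge : ℝ≥0
  isLevy : IsLevyMeasure toMeasure

namespace ExtLevyMeasure

/-- The distribution function `G(x) = ∫_{[0,x]} G(dy)`. -/
def distrib (G : ExtLevyMeasure) (x : ℝ≥0) : ℝ :=
  (G.toMeasure (Icc 0 x)).toReal

/-- The tail `∫_{[x,∞]} y⁻¹ G(dy)` for `x > 0`, which includes the charge at `∞`. -/
def tail (G : ExtLevyMeasure) (x : ℝ≥0) : ℝ :=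
  (∫ y in Ici x, (y : ℝ)⁻¹ ∂G.toMeasure) + G.charge

/-- Convergence of a sequence of extended Lévy measures `Gs` to `G`: the distribution functions
and the tails converge at every point `x ∈ (0, ∞)` of continuity of `G`. -/
def ConvergesTo (Gs : ℕ → ExtLevyMeasure) (G : ExtLevyMeasure) : Prop :=
  ∀ x : ℝ≥0, 0 < x → ContinuousAt G.distrib x →
    Tendsto (fun n => (Gs n).distrib x) atTop (𝓝 (G.distrib x)) ∧
    Tendsto (fun n => (Gs n).tail x) atTop (𝓝 (G.tail x))

/-- The first-order Laplace exponent
`Φ(q) = ∫_{[0,∞]} (1 - e^{-qx}) x⁻¹ G(dx)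
      = q g₀ + g_∞ + ∫_{(0,∞)} (1 - e^{-qx}) x⁻¹ G(dx)`, `g₀ = G({0})`,
for complex `q` with positive real part. -/
def laplaceOne (G : ExtLevyMeasure) (q : ℂ) : ℂ :=
  q * ((G.toMeasure {0}).toReal : ℂ) + ((G.charge : ℝ) : ℂ)
    + ∫ x in Ioi (0 : ℝ≥0), (1 - Complex.exp (-q * ((x : ℝ) : ℂ))) / ((x : ℝ) : ℂ) ∂G.toMeasure

/-- The second-order Laplace exponent
`Ψ(q) = ∫_{[0,∞]} (e^{-qx} - 1 + qx) x⁻² G(dx)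
      = q² g₀ / 2 + q g_∞ + ∫_{(0,∞)} (e^{-qx} - 1 + qx) x⁻² G(dx)`, `g₀ = G({0})`,
for complex `q` with positive real part. -/
def laplaceTwo (G : ExtLevyMeasure) (q : ℂ) : ℂ :=
  q ^ 2 / 2 * ((G.toMeasure {0}).toReal : ℂ) + q * ((G.charge : ℝ) : ℂ)
    + ∫ x in Ioi (0 : ℝ≥0),
        (Complex.exp (-q * ((x : ℝ) : ℂ)) - 1 + q * ((x : ℝ) : ℂ)) / ((x : ℝ) : ℂ) ^ 2
          ∂G.toMeasure

end ExtLevyMeasure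

end

/-! The map `y ↦ u = e^{-y}` identifies `[0,∞]` with `[0,1]`, sending `∞` to `0`. Weighting `G` by
`(1 - e^{-y})/y`, which is comparable to `1 ∧ y⁻¹`, and placing the charge at `u = 0`, turns
extended Lévy measures into finite measures on `[0,1]`; `pairing` is integration against them. All
three conditions amount to weak convergence of these measures.

Unit differences of `Φ` in `q` are the moments `∫ u^k`, and `Φ(1)` is the total mass, so (ii) yields
a limit by Weierstrass and Riesz (`exists_tendsto_pairing_of_laplaceOne`). Second differences of `Ψ`
give only `∫ u^k w`, where `w` vanishes exactly at `u = 0`. These reach every function vanishing at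
`0`, and `Ψ(1)` supplies the missing direction and the mass bound
(`exists_tendsto_pairing_of_laplaceTwo`).

Sandwiching by cutoffs turns weak convergence into `ConvergesTo` (`convergesTo_of_tendsto_pairing`).
The converse is compactness of bounded moment sequences together with uniqueness of limits
(`tendsto_pairing_of_convergesTo`). -/

noncomputable section

/-! ### Kernels of the Laplace exponents -/

/-- The kernel `(1 - e^{-qy}) / y`, continuously extended by `q` at `y = 0`. -/
def kernelOne (q y : ℝ) : ℝ := ∫ s in (0 : ℝ)..1, q * Real.exp (-(q * y * s))

/-- The kernel `(e^{-qy} - 1 + qy) / y ^ 2`, continuously extended by `q ^ 2 / 2` at `y = 0`. -/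
def kernelTwo (q y : ℝ) : ℝ := ∫ s in (0 : ℝ)..1, (1 - s) * q ^ 2 * Real.exp (-(q * y * s))

/-- The integral form removes the singularity at `y = 0`: the integrand is jointly continuous. -/
theorem continuous_kernelOne (q : ℝ) : Continuous (kernelOne q) := by
  unfold kernelOne
  apply intervalIntegral.continuous_parametric_intervalIntegral_of_continuous'
  unfold Function.uncurry
  fun_prop

theorem continuous_kernelTwo (q : ℝ) : Continuous (kernelTwo q) := by
  unfold kernelTwo
  apply intervalIntegral.continuous_parametric_intervalIntegral_of_continuous'
  unfold Function.uncurry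
  fun_prop

@[simp] theorem kernelOne_zero_right (q : ℝ) : kernelOne q 0 = q := by simp [kernelOne]

@[simp] theorem kernelTwo_zero_right (q : ℝ) : kernelTwo q 0 = q ^ 2 / 2 := by
  simp only [kernelTwo, mul_zero, zero_mul, neg_zero, Real.exp_zero, mul_one,
    intervalIntegral.integral_mul_const]
  rw [intervalIntegral.integral_sub (by simp) (by simp)]
  simp
  ring

theorem kernelOne_of_ne_zero (q : ℝ) {y : ℝ} (hy : y ≠ 0) :
    kernelOne q y = (1 - Real.exp (-(q * y))) / y := by
  have h : ∀ s : ℝ, HasDerivAt (fun s => -(Real.exp (-(q * y * s)) / y))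
      (q * Real.exp (-(q * y * s))) s := by
    intro s
    have := ((((hasDerivAt_id s).const_mul (q * y)).neg.exp).div_const y).neg
    convert! this using 1
    simp; field_simp
  rw [kernelOne, intervalIntegral.integral_eq_sub_of_hasDerivAt (fun s _ => h s)
    (Continuous.intervalIntegrable (by fun_prop) _ _)]
  simp; ring

theorem kernelTwo_of_ne_zero (q : ℝ) {y : ℝ} (hy : y ≠ 0) :
    kernelTwo q y = (Real.exp (-(q * y)) - 1 + q * y) / y ^ 2 := by
  have h : ∀ s : ℝ, HasDerivAt
      -- Antiderivative found by integrating by parts.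
      (fun s => Real.exp (-(q * y * s)) * (1 / y ^ 2 - (1 - s) * q / y))
      ((1 - s) * q ^ 2 * Real.exp (-(q * y * s))) s := by
    intro s
    have h1 := (((hasDerivAt_id s).const_mul (q * y)).neg.exp)
    have h2 := ((((hasDerivAt_id s).const_sub 1).mul_const q).div_const y).const_sub (1 / y ^ 2)
    convert! h1.mul h2 using 1
    simp; field_simp; ring
  rw [kernelTwo, intervalIntegral.integral_eq_sub_of_hasDerivAt (fun s _ => h s)
    (Continuous.intervalIntegrable (by fun_prop) _ _)]
  simp; field_simp; ring

theorem kernelOne_one_pos {y : ℝ} (hy : 0 ≤ y) : 0 < kernelOne 1 y := by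
  rcases hy.eq_or_lt with rfl | hy
  · simp
  · rw [kernelOne_of_ne_zero _ hy.ne']
    have : Real.exp (-(1 * y)) < 1 := by simpa using hy
    exact div_pos (by linarith) hy

theorem kernelTwo_one_pos {y : ℝ} (hy : 0 ≤ y) : 0 < kernelTwo 1 y := by
  rcases hy.eq_or_lt with rfl | hy
  · simp
  · rw [kernelTwo_of_ne_zero _ hy.ne']
    have : -y + 1 < Real.exp (-y) := Real.add_one_lt_exp (by simpa using hy.ne')
    simp only [one_mul]
    exact div_pos (by linarith) (by positivity)

theorem mul_kernelOne (q y : ℝ) : y * kernelOne q y = 1 - Real.exp (-(q * y)) := by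
  rcases eq_or_ne y 0 with rfl | hy
  · simp
  · rw [kernelOne_of_ne_zero q hy]; field_simp

theorem kernelOne_one_le_one {y : ℝ} (hy : 0 ≤ y) : kernelOne 1 y ≤ 1 := by
  rcases hy.eq_or_lt with rfl | hy
  · simp
  · rw [kernelOne_of_ne_zero _ hy.ne', div_le_one hy]
    have := Real.add_one_le_exp (-y)
    simp only [one_mul]; linarith

theorem kernelOne_one_le_inv {y : ℝ} (hy : 0 < y) : kernelOne 1 y ≤ y⁻¹ := by
  rw [kernelOne_of_ne_zero _ hy.ne', div_eq_mul_inv]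
  have := Real.exp_pos (-(1 * y))
  have : 0 < y⁻¹ := by positivity
  nlinarith

theorem min_one_inv_le_kernelOne_one {y : ℝ} (hy : 0 < y) : min 1 y⁻¹ ≤ 2 * kernelOne 1 y := by
  -- This is `e^y ≥ 1 + y` in disguise; `1 + y` is at most `2` or at most `2y`.
  have h1 : 1 ≤ (1 + y) * kernelOne 1 y := by
    simp only [kernelOne_of_ne_zero _ hy.ne', one_mul]
    rw [← mul_div_assoc, le_div_iff₀ hy, one_mul, Real.exp_neg]
    have h := Real.add_one_le_exp y
    have h2 : (Real.exp y)⁻¹ ≤ (1 + y)⁻¹ := by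
      apply inv_anti₀ <;> linarith
    have h3 : (1 + y) * (1 + y)⁻¹ = 1 := mul_inv_cancel₀ (by linarith)
    nlinarith
  have hp := kernelOne_one_pos hy.le
  rcases le_total y 1 with h | h
  · refine (min_le_left _ _).trans (h1.trans ?_)
    nlinarith
  · refine (min_le_right _ _).trans ?_
    rw [inv_le_iff_one_le_mul₀ hy]
    nlinarith

theorem kernelOne_succ_sub (q y : ℝ) :
    kernelOne (q + 1) y - kernelOne q y = Real.exp (-(q * y)) * kernelOne 1 y := by
  rcases eq_or_ne y 0 with rfl | hy
  · simp
  · simp only [kernelOne_of_ne_zero _ hy, add_mul, neg_add, Real.exp_add]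
    field_simp; ring

/-- One factor `kernelOne 1 y` is the weight built into `pairing`; the other remains as the function
`w`. -/
theorem kernelTwo_second_difference (q y : ℝ) :
    kernelTwo (q + 2) y - 2 * kernelTwo (q + 1) y + kernelTwo q y
      = Real.exp (-(q * y)) * kernelOne 1 y * kernelOne 1 y := by
  rcases eq_or_ne y 0 with rfl | hy
  · simp; ring
  · have : Real.exp (-(2 * y)) = Real.exp (-y) * Real.exp (-y) := by
      rw [← Real.exp_add]; ring_nf
    simp only [kernelOne_of_ne_zero _ hy, kernelTwo_of_ne_zero _ hy, add_mul, neg_add,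
      Real.exp_add, this, one_mul]
    field_simp; ring

theorem tendsto_exp_neg_mul_atTop {q : ℝ} (hq : 0 < q) :
    Tendsto (fun y : ℝ => Real.exp (-(q * y))) atTop (𝓝 0) :=
  Real.tendsto_exp_neg_atTop_nhds_zero.comp (tendsto_id.const_mul_atTop hq)

theorem tendsto_mul_kernelOne {q : ℝ} (hq : 0 < q) :
    Tendsto (fun y : ℝ => y * kernelOne q y) atTop (𝓝 1) := by
  simp only [mul_kernelOne]
  simpa using (tendsto_exp_neg_mul_atTop hq).const_sub 1

theorem tendsto_kernelOne_one : Tendsto (kernelOne 1) atTop (𝓝 0) := by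
  have := (tendsto_mul_kernelOne one_pos).mul tendsto_inv_atTop_zero
  rw [one_mul] at this
  refine this.congr' ?_
  filter_upwards [eventually_gt_atTop 0] with y hy
  field_simp

theorem tendsto_mul_kernelTwo {q : ℝ} (hq : 0 < q) :
    Tendsto (fun y : ℝ => y * kernelTwo q y) atTop (𝓝 q) := by
  have := (((tendsto_exp_neg_mul_atTop hq).sub_const 1).mul tendsto_inv_atTop_zero).add_const q
  rw [mul_zero, zero_add] at this
  refine this.congr' ?_
  filter_upwards [eventually_gt_atTop 0] with y hy
  rw [kernelTwo_of_ne_zero _ hy.ne']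
  field_simp

/-! ### The coordinate `u = e^{-y}` on `[0,∞]` -/

/-- The homeomorphism `y ↦ e^{-y}` of `[0, ∞)` onto `(0, 1]`. -/
def expNeg (y : ℝ≥0) : unitInterval :=
  ⟨Real.exp (-y), (Real.exp_pos _).le, by simp⟩

theorem continuous_expNeg : Continuous expNeg := by
  unfold expNeg; fun_prop

@[simp] theorem coe_expNeg (y : ℝ≥0) : (expNeg y : ℝ) = Real.exp (-y) := rfl

/-- The inverse `u ↦ -log u` of `expNeg`. -/
def negLog (u : unitInterval) : ℝ≥0 := Real.toNNReal (-Real.log u)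

theorem measurable_negLog : Measurable negLog := by
  unfold negLog; fun_prop

/-- Fails at `u = 0`: the convention `log 0 = 0` makes `negLog 0 = 0`, whose image is `1`. -/
theorem expNeg_negLog {u : unitInterval} (hu : u ≠ 0) : expNeg (negLog u) = u := by
  have h : 0 < (u : ℝ) := unitInterval.pos_iff_ne_zero.2 hu
  ext
  rw [coe_expNeg, negLog, Real.coe_toNNReal _ (by simpa using Real.log_nonpos u.2.1 u.2.2), neg_neg,
    Real.exp_log h]

@[simp] theorem negLog_expNeg (y : ℝ≥0) : negLog (expNeg y) = y := by
  simp [negLog]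

theorem expNeg_ne_zero (y : ℝ≥0) : expNeg y ≠ 0 := by
  intro h
  have := congrArg Subtype.val h
  simp at this

theorem exists_continuousMap_comp_expNeg {F : ℝ≥0 → ℝ} {c : ℝ} (hF : Continuous F)
    (hc : Tendsto F atTop (𝓝 c)) :
    ∃ f : C(unitInterval, ℝ), (∀ y, f (expNeg y) = F y) ∧ f 0 = c := by
  classical
  refine ⟨⟨fun u => if u = 0 then c else F (negLog u), ?_⟩, ?_, ?_⟩
  · rw [continuous_iff_continuousAt]
    intro u
    rcases eq_or_ne u 0 with rfl | hu
    · rw [continuousAt_iff_punctured_nhds]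
      simp only [if_true]
      have h0 : Tendsto (fun u : unitInterval => (u : ℝ)) (𝓝[≠] 0) (𝓝[>] 0) := by
        refine tendsto_nhdsWithin_of_tendsto_nhds_of_eventually_within _ ?_ ?_
        · exact (continuous_subtype_val.tendsto (0 : unitInterval)).mono_left nhdsWithin_le_nhds
        · filter_upwards [self_mem_nhdsWithin] with u hu
          exact unitInterval.pos_iff_ne_zero.2 hu
      have h1 : Tendsto negLog (𝓝[≠] 0) atTop :=
        Real.tendsto_toNNReal_atTop.comp
          (tendsto_neg_atBot_atTop.comp (Real.tendsto_log_nhdsGT_zero.comp h0))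
      refine (hc.comp h1).congr' ?_
      filter_upwards [self_mem_nhdsWithin] with u hu
      simp [show u ≠ 0 from hu]
    · have h : (u : ℝ) ≠ 0 := fun h => hu (Subtype.ext h)
      have h1 : ContinuousAt (fun u => F (negLog u)) u := by
        refine hF.continuousAt.comp ?_
        unfold negLog
        refine continuous_real_toNNReal.continuousAt.comp ?_
        exact (ContinuousAt.log (by fun_prop) h).neg
      refine h1.congr ?_
      filter_upwards [isOpen_ne.mem_nhds hu] with v hv
      simp [show v ≠ 0 from hv]
  · intro y
    simp [expNeg_ne_zero]
  · simp

theorem eq_of_comp_expNeg {f g : C(unitInterval, ℝ)} (h : ∀ y, f (expNeg y) = g (expNeg y))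
    (h0 : f 0 = g 0) : f = g := by
  ext u
  by_cases hu : u = 0
  · rw [hu, h0]
  · rw [← expNeg_negLog hu, h]


/-- Since `y * kernelOne 1 y → 1` at infinity, the quotient `H / kernelOne 1` has the limit of `y *
H y` there. -/
theorem exists_mul_kernelOne_eq {H : ℝ≥0 → ℝ} {c : ℝ} (hH : Continuous H)
    (hc : Tendsto (fun y : ℝ≥0 => y * H y) atTop (𝓝 c)) :
    ∃ f : C(unitInterval, ℝ), (∀ y : ℝ≥0, f (expNeg y) * kernelOne 1 y = H y) ∧ f 0 = c := by
  have hpos : ∀ y : ℝ≥0, kernelOne 1 y ≠ 0 := fun y => (kernelOne_one_pos y.coe_nonneg).ne'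
  have hcont : Continuous fun y : ℝ≥0 => H y / kernelOne 1 y :=
    hH.div ((continuous_kernelOne 1).comp NNReal.continuous_coe) hpos
  have hlim : Tendsto (fun y : ℝ≥0 => H y / kernelOne 1 y) atTop (𝓝 c) := by
    have h := hc.div ((tendsto_mul_kernelOne one_pos).comp
      (NNReal.tendsto_coe_atTop.2 tendsto_id)) one_ne_zero
    rw [div_one] at h
    refine h.congr' ?_
    filter_upwards [eventually_gt_atTop 0] with y hy
    have : (y : ℝ) ≠ 0 := by exact_mod_cast hy.ne'
    simp [mul_div_mul_left _ _ this]
  obtain ⟨f, hf, hf0⟩ := exists_continuousMap_comp_expNeg hcont hlim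
  exact ⟨f, fun y => by rw [hf, div_mul_cancel₀ _ (hpos y)], hf0⟩

theorem exists_mul_kernelOne_eq_kernelOne {q : ℝ} (hq : 0 < q) :
    ∃ f : C(unitInterval, ℝ), (∀ y : ℝ≥0, f (expNeg y) * kernelOne 1 y = kernelOne q y) ∧
      f 0 = 1 :=
  exists_mul_kernelOne_eq ((continuous_kernelOne q).comp NNReal.continuous_coe)
    ((tendsto_mul_kernelOne hq).comp (NNReal.tendsto_coe_atTop.2 tendsto_id))

theorem exists_mul_kernelOne_eq_kernelTwo {q : ℝ} (hq : 0 < q) :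
    ∃ f : C(unitInterval, ℝ), (∀ y : ℝ≥0, f (expNeg y) * kernelOne 1 y = kernelTwo q y) ∧
      f 0 = q :=
  exists_mul_kernelOne_eq ((continuous_kernelTwo q).comp NNReal.continuous_coe)
    ((tendsto_mul_kernelTwo hq).comp (NNReal.tendsto_coe_atTop.2 tendsto_id))

theorem exists_comp_expNeg_eq_kernelOne_one :
    ∃ f : C(unitInterval, ℝ), (∀ y : ℝ≥0, f (expNeg y) = kernelOne 1 y) ∧ f 0 = 0 :=
  exists_continuousMap_comp_expNeg ((continuous_kernelOne 1).comp NNReal.continuous_coe)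
    (tendsto_kernelOne_one.comp (NNReal.tendsto_coe_atTop.2 tendsto_id))

/-! ### Extended Lévy measures as positive functionals on `C([0,1])` -/

namespace ExtLevyMeasure

theorem min_one_inv_coe {y : ℝ≥0} (hy : 0 < y) :
    min 1 (y : ℝ≥0∞)⁻¹ = ENNReal.ofReal (min 1 (y : ℝ)⁻¹) := by
  rw [ENNReal.ofReal_min, ENNReal.ofReal_one, ENNReal.ofReal_inv_of_pos (by exact_mod_cast hy),
    ENNReal.ofReal_coe_nnreal]

theorem integrable_kernelOne_one (G : ExtLevyMeasure) :
    Integrable (fun y : ℝ≥0 => kernelOne 1 y) G.toMeasure := by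
  refine ⟨((continuous_kernelOne 1).comp NNReal.continuous_coe).aestronglyMeasurable, ?_⟩
  refine lt_of_le_of_lt (lintegral_mono fun y => ?_) G.isLevy
  simp only [Real.enorm_eq_ofReal (kernelOne_one_pos y.coe_nonneg).le]
  rcases eq_or_ne y 0 with rfl | hy
  · simp
  · have hy : 0 < y := pos_iff_ne_zero.2 hy
    rw [min_one_inv_coe hy]
    exact ENNReal.ofReal_le_ofReal
      (le_min (kernelOne_one_le_one y.coe_nonneg) (kernelOne_one_le_inv (by exact_mod_cast hy)))

theorem integrable_mul_kernelOne (G : ExtLevyMeasure) (f : C(unitInterval, ℝ)) :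
    Integrable (fun y : ℝ≥0 => f (expNeg y) * kernelOne 1 y) G.toMeasure :=
  G.integrable_kernelOne_one.bdd_mul (c := ‖f‖)
    (f.continuous.comp continuous_expNeg).aestronglyMeasurable
    (Eventually.of_forall fun _ => f.norm_coe_le_norm _)

/-- The functional `f ↦ ∫_{[0,∞]} f(e^{-y}) (1 - e^{-y}) y⁻¹ G(dy)` on `C([0,1])`, where `f(0)` is
weighted with the charge at `∞`. -/
def pairing (G : ExtLevyMeasure) : C(unitInterval, ℝ) →ₗ[ℝ] ℝ where
  toFun f := (∫ y : ℝ≥0, f (expNeg y) * kernelOne 1 y ∂G.toMeasure) + G.charge * f 0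
  map_add' f g := by
    simp only [ContinuousMap.add_apply, add_mul]
    rw [integral_add (G.integrable_mul_kernelOne f) (G.integrable_mul_kernelOne g)]
    ring
  map_smul' c f := by
    simp only [ContinuousMap.smul_apply, smul_eq_mul, mul_assoc, RingHom.id_apply]
    rw [integral_const_mul]
    ring

theorem pairing_apply (G : ExtLevyMeasure) (f : C(unitInterval, ℝ)) :
    G.pairing f = (∫ y : ℝ≥0, f (expNeg y) * kernelOne 1 y ∂G.toMeasure) + G.charge * f 0 := rfl

theorem pairing_nonneg (G : ExtLevyMeasure) {f : C(unitInterval, ℝ)} (hf : 0 ≤ f) :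
    0 ≤ G.pairing f :=
  add_nonneg (integral_nonneg fun y => mul_nonneg (hf _) (kernelOne_one_pos y.coe_nonneg).le)
    (mul_nonneg G.charge.coe_nonneg (hf 0))

theorem pairing_mono (G : ExtLevyMeasure) {f g : C(unitInterval, ℝ)} (h : f ≤ g) :
    G.pairing f ≤ G.pairing g := by
  have := G.pairing_nonneg (sub_nonneg.2 h)
  rwa [map_sub, sub_nonneg] at this

theorem abs_pairing_le (G : ExtLevyMeasure) (f : C(unitInterval, ℝ)) :
    |G.pairing f| ≤ ‖f‖ * G.pairing 1 := by
  have h (x) : |f x| ≤ ‖f‖ := f.norm_coe_le_norm x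
  rw [← smul_eq_mul, ← map_smul, abs_le, ← map_neg]
  constructor <;> refine G.pairing_mono fun x => ?_
  · simpa using (abs_le.1 (h x)).1
  · simpa using (abs_le.1 (h x)).2

theorem setIntegral_Ioi_zero (G : ExtLevyMeasure) {F : ℝ≥0 → ℝ} (hF : Integrable F G.toMeasure) :
    ∫ y, F y ∂G.toMeasure
      = F 0 * (G.toMeasure {0}).toReal + ∫ y in Ioi 0, F y ∂G.toMeasure := by
  have h : ({0} : Set ℝ≥0)ᶜ = Ioi 0 := by ext y; simp [pos_iff_ne_zero]
  rw [← integral_add_compl (measurableSet_singleton 0) hF, h, integral_singleton, smul_eq_mul,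
    mul_comm, measureReal_def]

/-- The term `q g₀` is absorbed because the kernel takes the value `q` at `0`. -/
theorem laplaceOne_ofReal (G : ExtLevyMeasure) {q : ℝ} (hq : 0 < q) :
    G.laplaceOne q = ((∫ y : ℝ≥0, kernelOne q y ∂G.toMeasure) + G.charge : ℝ) := by
  obtain ⟨f, hf, -⟩ := exists_mul_kernelOne_eq_kernelOne hq
  have hint : Integrable (fun y : ℝ≥0 => kernelOne q y) G.toMeasure := by
    simpa only [hf] using G.integrable_mul_kernelOne f
  have h : ∫ x in Ioi (0 : ℝ≥0), (1 - Complex.exp (-q * ((x : ℝ) : ℂ))) / ((x : ℝ) : ℂ) ∂G.toMeasure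
      = ((∫ y in Ioi (0 : ℝ≥0), kernelOne q y ∂G.toMeasure : ℝ) : ℂ) := by
    rw [← integral_complex_ofReal]
    refine setIntegral_congr_fun measurableSet_Ioi fun y hy => ?_
    have hy : (y : ℝ) ≠ 0 := by exact_mod_cast (show 0 < y from hy).ne'
    simp [kernelOne_of_ne_zero _ hy]
  rw [laplaceOne, h, G.setIntegral_Ioi_zero hint]
  simp
  ring

theorem laplaceTwo_ofReal (G : ExtLevyMeasure) {q : ℝ} (hq : 0 < q) :
    G.laplaceTwo q = ((∫ y : ℝ≥0, kernelTwo q y ∂G.toMeasure) + G.charge * q : ℝ) := by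
  obtain ⟨f, hf, -⟩ := exists_mul_kernelOne_eq_kernelTwo hq
  have hint : Integrable (fun y : ℝ≥0 => kernelTwo q y) G.toMeasure := by
    simpa only [hf] using G.integrable_mul_kernelOne f
  have h : ∫ x in Ioi (0 : ℝ≥0), (Complex.exp (-q * ((x : ℝ) : ℂ)) - 1 + q * ((x : ℝ) : ℂ))
        / ((x : ℝ) : ℂ) ^ 2 ∂G.toMeasure
      = ((∫ y in Ioi (0 : ℝ≥0), kernelTwo q y ∂G.toMeasure : ℝ) : ℂ) := by
    rw [← integral_complex_ofReal]
    refine setIntegral_congr_fun measurableSet_Ioi fun y hy => ?_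
    have hy : (y : ℝ) ≠ 0 := by exact_mod_cast (show 0 < y from hy).ne'
    simp [kernelTwo_of_ne_zero _ hy]
  rw [laplaceTwo, h, G.setIntegral_Ioi_zero hint]
  simp
  ring

theorem laplaceOne_eq_pairing {q : ℝ} (hq : 0 < q) {f : C(unitInterval, ℝ)}
    (hf : ∀ y : ℝ≥0, f (expNeg y) * kernelOne 1 y = kernelOne q y) (hf0 : f 0 = 1)
    (G : ExtLevyMeasure) : G.laplaceOne q = (G.pairing f : ℂ) := by
  rw [G.laplaceOne_ofReal hq, pairing_apply]
  simp only [hf, hf0, mul_one]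

theorem laplaceTwo_eq_pairing {q : ℝ} (hq : 0 < q) {f : C(unitInterval, ℝ)}
    (hf : ∀ y : ℝ≥0, f (expNeg y) * kernelOne 1 y = kernelTwo q y) (hf0 : f 0 = q)
    (G : ExtLevyMeasure) : G.laplaceTwo q = (G.pairing f : ℂ) := by
  rw [G.laplaceTwo_ofReal hq, pairing_apply]
  simp only [hf, hf0]

end ExtLevyMeasure

/-! ### Riesz representation, moments and closed subspaces -/

namespace ExtLevyMeasure

/-- The atom of `ν` at `0` becomes the charge; the rest is carried to `[0,∞)` by `negLog` and
divided by the weight. The Lévy condition follows since `(1 ∧ y⁻¹)/kernelOne 1 y ≤ 2`. -/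
theorem exists_pairing_eq_integral (ν : Measure unitInterval) [IsFiniteMeasure ν] :
    ∃ G : ExtLevyMeasure, ∀ f : C(unitInterval, ℝ), G.pairing f = ∫ u, f u ∂ν := by
  have hd : Measurable fun y : ℝ≥0 => ENNReal.ofReal (kernelOne 1 y)⁻¹ :=
    ((continuous_kernelOne 1).comp NNReal.continuous_coe).measurable.inv.ennreal_ofReal
  let m : Measure ℝ≥0 := (ν.restrict {0}ᶜ).map negLog
  refine ⟨⟨m.withDensity fun y => ENNReal.ofReal (kernelOne 1 y)⁻¹, (ν {0}).toNNReal, ?_⟩, ?_⟩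
  · unfold IsLevyMeasure
    rw [lintegral_withDensity_eq_lintegral_mul _ hd (by fun_prop)]
    refine lt_of_le_of_lt (lintegral_mono (g := fun _ => 2) fun y => ?_) ?_
    · rcases eq_or_ne y 0 with rfl | hy
      · simp
      · have hy : 0 < y := pos_iff_ne_zero.2 hy
        have hy' : 0 < (y : ℝ) := by exact_mod_cast hy
        have hw := kernelOne_one_pos hy'.le
        rw [Pi.mul_apply, min_one_inv_coe hy, ← ENNReal.ofReal_mul (by positivity),
          ← ENNReal.ofReal_ofNat]
        refine ENNReal.ofReal_le_ofReal ?_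
        rw [inv_mul_le_iff₀ hw, mul_comm]
        exact min_one_inv_le_kernelOne_one hy'
    · rw [lintegral_const]
      exact ENNReal.mul_lt_top (by simp) (measure_lt_top _ _)
  · intro f
    have h0 : MeasurableSet ({0} : Set unitInterval) := measurableSet_singleton 0
    have hfint : Integrable (fun u => f u) ν :=
      Integrable.of_bound f.continuous.aestronglyMeasurable ‖f‖
        (Eventually.of_forall f.norm_coe_le_norm)
    rw [pairing_apply, integral_withDensity_eq_integral_toReal_smul hd (by simp)]
    have h1 : ∀ y : ℝ≥0, (ENNReal.ofReal (kernelOne 1 y)⁻¹).toReal •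
        (f (expNeg y) * kernelOne 1 y) = f (expNeg y) := fun y => by
      have hw := kernelOne_one_pos y.coe_nonneg
      rw [ENNReal.toReal_ofReal (by positivity), smul_eq_mul]
      field_simp
    simp only [h1]
    rw [integral_map measurable_negLog.aemeasurable
      (show AEStronglyMeasurable (fun y => f (expNeg y)) _ from
        (f.continuous.comp continuous_expNeg).aestronglyMeasurable),
      ← integral_add_compl h0 hfint, integral_singleton, add_comm]
    congr 1
    exact setIntegral_congr_fun h0.compl fun u hu => by rw [expNeg_negLog hu]

/-- A pointwise limit of the functionals `pairing` is again such a functional. -/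
theorem exists_tendsto_pairing {Gs : ℕ → ExtLevyMeasure}
    (h : ∀ f, ∃ l, Tendsto (fun n => (Gs n).pairing f) atTop (𝓝 l)) :
    ∃ G : ExtLevyMeasure, ∀ f, Tendsto (fun n => (Gs n).pairing f) atTop (𝓝 (G.pairing f)) := by
  choose l hl using h
  -- The Riesz theorem speaks of compactly supported functions, which on `[0,1]` are all continuous
  -- ones.
  let e (f : CompactlySupportedContinuousMap unitInterval ℝ) : C(unitInterval, ℝ) := f
  let L₀ : CompactlySupportedContinuousMap unitInterval ℝ →ₗ[ℝ] ℝ :=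
    { toFun := fun f => l (e f)
      map_add' := fun f g => by
        refine tendsto_nhds_unique (hl _) ?_
        have h : e (f + g) = e f + e g := rfl
        simpa only [h, map_add] using (hl (e f)).add (hl (e g))
      map_smul' := fun c f => by
        refine tendsto_nhds_unique (hl _) ?_
        have h : e (c • f) = c • e f := rfl
        simpa only [h, map_smul, RingHom.id_apply] using (hl (e f)).const_smul c }
  let L : CompactlySupportedContinuousMap unitInterval ℝ →ₚ[ℝ] ℝ := PositiveLinearMap.mk₀ L₀
    fun f hf => ge_of_tendsto' (hl _) fun n => (Gs n).pairing_nonneg fun x => hf x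
  obtain ⟨G, hG⟩ := exists_pairing_eq_integral (RealRMK.rieszMeasure L)
  refine ⟨G, fun f => ?_⟩
  have h := RealRMK.integral_rieszMeasure L (CompactlySupportedContinuousMap.continuousMapEquiv f)
  rw [hG f]
  exact (show ∫ u, f u ∂(RealRMK.rieszMeasure L) = l f from h) ▸ hl f

/-- The continuous functions against which the sequence `Gs` has convergent integrals. -/
def convergenceSubmodule (Gs : ℕ → ExtLevyMeasure) : Submodule ℝ C(unitInterval, ℝ) where
  carrier := {f | ∃ l, Tendsto (fun n => (Gs n).pairing f) atTop (𝓝 l)}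
  add_mem' := by
    rintro f g ⟨a, ha⟩ ⟨b, hb⟩
    exact ⟨a + b, by simpa only [map_add] using ha.add hb⟩
  zero_mem' := ⟨0, by simp⟩
  smul_mem' := by
    rintro c f ⟨a, ha⟩
    exact ⟨c • a, by simpa only [map_smul] using ha.const_smul c⟩

theorem mem_convergenceSubmodule {Gs : ℕ → ExtLevyMeasure} {f : C(unitInterval, ℝ)} :
    f ∈ convergenceSubmodule Gs ↔ ∃ l, Tendsto (fun n => (Gs n).pairing f) atTop (𝓝 l) := Iff.rfl

/-- Bounded masses make the functionals equicontinuous, so an `ε/3` argument applies. -/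
theorem isClosed_convergenceSubmodule {Gs : ℕ → ExtLevyMeasure} {C : ℝ}
    (hC : ∀ n, (Gs n).pairing 1 ≤ C) :
    IsClosed (convergenceSubmodule Gs : Set C(unitInterval, ℝ)) := by
  have hC0 : 0 ≤ C := ((Gs 0).pairing_nonneg (f := 1) fun _ => by simp).trans (hC 0)
  refine isClosed_of_closure_subset fun f hf => cauchySeq_tendsto_of_complete ?_
  rw [Metric.cauchySeq_iff]
  intro ε hε
  obtain ⟨g, ⟨l, hl⟩, hg⟩ := Metric.mem_closure_iff.1 hf (ε / (3 * (C + 1))) (by positivity)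
  obtain ⟨N, hN⟩ := Metric.cauchySeq_iff.1 hl.cauchySeq (ε / 3) (by positivity)
  refine ⟨N, fun m hm n hn => ?_⟩
  have hb (k) : |(Gs k).pairing f - (Gs k).pairing g| < ε / 3 := by
    rw [← map_sub]
    calc |(Gs k).pairing (f - g)| ≤ ‖f - g‖ * (Gs k).pairing 1 := (Gs k).abs_pairing_le _
      _ ≤ ‖f - g‖ * (C + 1) := by gcongr; linarith [hC k]
      _ < ε / (3 * (C + 1)) * (C + 1) := by
        rw [dist_eq_norm] at hg
        gcongr
      _ = ε / 3 := by field_simp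
  have h1 := abs_lt.1 (hb m)
  have h2 := abs_lt.1 (hb n)
  have h3 := hN m hm n hn
  rw [Real.dist_eq, abs_lt] at h3 ⊢
  constructor <;> linarith [h1.1, h1.2, h2.1, h2.2, h3.1, h3.2]

/-- The function `u ↦ u ^ k` on the unit interval. -/
def monomialMap (k : ℕ) : C(unitInterval, ℝ) := ⟨fun u => (u : ℝ) ^ k, by fun_prop⟩

@[simp] theorem monomialMap_apply (k : ℕ) (u : unitInterval) : monomialMap k u = (u : ℝ) ^ k := rfl

theorem monomialMap_zero : monomialMap 0 = 1 := by ext; simp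

/-- A closed subspace containing all multiples `u ^ k * w` contains all multiples of `w`. -/
theorem mul_mem_of_monomialMap_mul_mem {L : Submodule ℝ C(unitInterval, ℝ)}
    (hL : IsClosed (L : Set C(unitInterval, ℝ))) {w : C(unitInterval, ℝ)}
    (h : ∀ k, monomialMap k * w ∈ L) (f : C(unitInterval, ℝ)) : f * w ∈ L := by
  have hf : f ∈ (polynomialFunctions unitInterval).topologicalClosure := by
    rw [polynomialFunctions_closure_eq_top']; trivial
  -- Weierstrass: the `f` with `f * w ∈ L` form a closed set, so polynomials suffice.
  refine closure_minimal (s := (polynomialFunctions unitInterval : Set C(unitInterval, ℝ)))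
    (t := {f | f * w ∈ L}) ?_ (hL.preimage (continuous_mul_const w)) hf
  rw [polynomialFunctions_coe]
  rintro _ ⟨p, rfl⟩
  have : (Polynomial.toContinuousMapOnAlgHom unitInterval p) * w
      = p.sum fun k a => a • (monomialMap k * w) := by
    ext u
    simp only [ContinuousMap.mul_apply, Polynomial.toContinuousMapOnAlgHom_apply,
      Polynomial.toContinuousMapOn_apply, Polynomial.toContinuousMap_apply, Polynomial.eval_eq_sum,
      Polynomial.sum, ContinuousMap.coe_sum, Finset.sum_apply, ContinuousMap.smul_apply,
      monomialMap_apply, smul_eq_mul, Finset.sum_mul, mul_assoc]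
  change _ * w ∈ L
  rw [this]
  exact Submodule.sum_mem _ fun k _ => L.smul_mem _ (h k)

/-- Convergence of all moments suffices for convergence. -/
theorem exists_tendsto_pairing_of_monomialMap {Gs : ℕ → ExtLevyMeasure}
    (h : ∀ k, monomialMap k ∈ convergenceSubmodule Gs) :
    ∃ G : ExtLevyMeasure, ∀ f, Tendsto (fun n => (Gs n).pairing f) atTop (𝓝 (G.pairing f)) := by
  obtain ⟨l, hl⟩ := h 0
  rw [monomialMap_zero] at hl
  obtain ⟨C, hC⟩ := hl.bddAbove_range
  have hC' (n) : (Gs n).pairing 1 ≤ C := hC ⟨n, rfl⟩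
  refine exists_tendsto_pairing fun f => ?_
  have := mul_mem_of_monomialMap_mul_mem (isClosed_convergenceSubmodule hC') (w := 1)
    (by simpa using h) f
  simpa [mem_convergenceSubmodule] using this

/-- A closed subspace of `C([0,1])` which contains `u ^ k * w` for all `k`, where `w` vanishes only
at `0`, and a function that does not vanish at `0`, is everything. -/
theorem eq_top_of_monomialMap_mul_mem {L : Submodule ℝ C(unitInterval, ℝ)}
    (hL : IsClosed (L : Set C(unitInterval, ℝ))) {w p : C(unitInterval, ℝ)}
    (hw : ∀ u, u ≠ 0 → w u ≠ 0) (h : ∀ k, monomialMap k * w ∈ L) (hp : p ∈ L) (hp0 : p 0 ≠ 0) :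
    L = ⊤ := by
  have h0 (f : C(unitInterval, ℝ)) (hf : f 0 = 0) : f ∈ L := by
    -- A closed ideal of `C([0,1])` is determined by its zero set, here contained in `{0}`.
    have hmem : f ∈ (Ideal.span {w}).closure := by
      rw [← ContinuousMap.idealOfSet_ofIdeal_eq_closure, ContinuousMap.mem_idealOfSet]
      intro u hu
      rw [Set.mem_compl_iff, ContinuousMap.notMem_setOfIdeal] at hu
      by_cases hu0 : u = 0
      · rw [hu0, hf]
      · exact absurd (hu (Ideal.mem_span_singleton_self w)) (hw u hu0)
    refine closure_minimal (s := (Ideal.span {w} : Set C(unitInterval, ℝ))) ?_ hL hmem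
    intro g hg
    obtain ⟨a, rfl⟩ := Ideal.mem_span_singleton'.1 hg
    exact mul_mem_of_monomialMap_mul_mem hL h a
  refine eq_top_iff.2 fun f _ => ?_
  have := L.add_mem (h0 (f - (f 0 / p 0) • p) (by simp [hp0])) (L.smul_mem (f 0 / p 0) hp)
  simpa using this

/-! ### From Laplace exponents to convergence of functionals -/

theorem exists_tendsto_of_ofReal {a : ℕ → ℝ} {l : ℂ}
    (h : Tendsto (fun n => (a n : ℂ)) atTop (𝓝 l)) : ∃ l', Tendsto a atTop (𝓝 l') :=
  ⟨l.re, (Complex.continuous_re.tendsto l).comp h⟩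

theorem exists_tendsto_pairing_of_laplaceOne {Gs : ℕ → ExtLevyMeasure}
    (h : ∀ q : ℝ, 0 < q → ∃ l : ℂ, Tendsto (fun n => (Gs n).laplaceOne q) atTop (𝓝 l)) :
    ∃ G : ExtLevyMeasure, ∀ f, Tendsto (fun n => (Gs n).pairing f) atTop (𝓝 (G.pairing f)) := by
  have key {q : ℝ} (hq : 0 < q) : ∃ f ∈ convergenceSubmodule Gs,
      (∀ y : ℝ≥0, f (expNeg y) * kernelOne 1 y = kernelOne q y) ∧ f 0 = 1 := by
    obtain ⟨f, hf, hf0⟩ := exists_mul_kernelOne_eq_kernelOne hq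
    obtain ⟨l, hl⟩ := h q hq
    simp only [laplaceOne_eq_pairing hq hf hf0] at hl
    exact ⟨f, exists_tendsto_of_ofReal hl, hf, hf0⟩
  have hw (y : ℝ≥0) : kernelOne 1 y ≠ 0 := (kernelOne_one_pos y.coe_nonneg).ne'
  refine exists_tendsto_pairing_of_monomialMap fun k => ?_
  obtain ⟨f₁, hm₁, hf₁, hf₁0⟩ := key (q := k + 1) (by positivity)
  -- For `k = 0` the difference would need the excluded `q = 0`; but `f₁` is then already the
  -- constant `1`.
  rcases k.eq_zero_or_pos with rfl | hk
  · convert! hm₁ using 1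
    refine eq_of_comp_expNeg (fun y => mul_right_cancel₀ (hw y) ?_) (by simp [hf₁0])
    rw [hf₁]
    simp
  · obtain ⟨f₂, hm₂, hf₂, hf₂0⟩ := key (q := k) (by positivity)
    convert! (convergenceSubmodule Gs).sub_mem hm₁ hm₂ using 1
    refine eq_of_comp_expNeg (fun y => mul_right_cancel₀ (hw y) ?_)
      (by simp [hf₁0, hf₂0, hk.ne'])
    rw [ContinuousMap.sub_apply, sub_mul, hf₁, hf₂, kernelOne_succ_sub]
    simp [← Real.exp_nat_mul]

theorem exists_tendsto_pairing_of_laplaceTwo {Gs : ℕ → ExtLevyMeasure}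
    (h : ∀ q : ℝ, 0 < q → ∃ l : ℂ, Tendsto (fun n => (Gs n).laplaceTwo q) atTop (𝓝 l)) :
    ∃ G : ExtLevyMeasure, ∀ f, Tendsto (fun n => (Gs n).pairing f) atTop (𝓝 (G.pairing f)) := by
  have key {q : ℝ} (hq : 0 ≤ q) : ∃ f ∈ convergenceSubmodule Gs,
      (∀ y : ℝ≥0, f (expNeg y) * kernelOne 1 y = kernelTwo q y) ∧ f 0 = q := by
    rcases hq.eq_or_lt with rfl | hq
    -- The value `q = 0`, needed for the second difference at `k = 0`, is free because `kernelTwo 0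
    -- = 0`.
    · exact ⟨0, zero_mem _, by simp [kernelTwo], by simp⟩
    obtain ⟨f, hf, hf0⟩ := exists_mul_kernelOne_eq_kernelTwo hq
    obtain ⟨l, hl⟩ := h q hq
    simp only [laplaceTwo_eq_pairing hq hf hf0] at hl
    exact ⟨f, exists_tendsto_of_ofReal hl, hf, hf0⟩
  have hw (y : ℝ≥0) : kernelOne 1 y ≠ 0 := (kernelOne_one_pos y.coe_nonneg).ne'
  obtain ⟨p, hpm, hp, hp0⟩ := key zero_le_one
  obtain ⟨w, hwe, hw0⟩ := exists_comp_expNeg_eq_kernelOne_one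
  have hppos (u) : 0 < p u := by
    by_cases hu : u = 0
    · rw [hu, hp0]; exact one_pos
    · have := hp (negLog u)
      rw [expNeg_negLog hu] at this
      exact pos_of_mul_pos_left (this ▸ kernelTwo_one_pos (negLog u).coe_nonneg)
        (kernelOne_one_pos (negLog u).coe_nonneg).le
  obtain ⟨u₀, -, hu₀⟩ := isCompact_univ.exists_isMinOn univ_nonempty p.continuous.continuousOn
  obtain ⟨l, hl⟩ := hpm
  obtain ⟨C, hC⟩ := hl.bddAbove_range
  -- The positive continuous `p` has a positive minimum `p u₀`, so `Ψ(1)` controls the mass.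
  have hC' (n) : (Gs n).pairing 1 ≤ (p u₀)⁻¹ * C := by
    have h1 : (1 : C(unitInterval, ℝ)) ≤ (p u₀)⁻¹ • p := fun u => by
      have := hu₀ (mem_univ u)
      change (1 : ℝ) ≤ (p u₀)⁻¹ * p u
      rw [le_inv_mul_iff₀ (hppos u₀), mul_one]
      exact this
    refine ((Gs n).pairing_mono h1).trans ?_
    rw [map_smul, smul_eq_mul]
    exact mul_le_mul_of_nonneg_left (hC ⟨n, rfl⟩) (inv_nonneg.2 (hppos u₀).le)
  have htop : convergenceSubmodule Gs = ⊤ := by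
    refine eq_top_of_monomialMap_mul_mem (isClosed_convergenceSubmodule hC') (w := w) (p := p) ?_ ?_
      ⟨l, hl⟩ (hppos 0).ne'
    · intro u hu
      rw [← expNeg_negLog hu, hwe]
      exact hw _
    · intro k
      obtain ⟨f₀, hm₀, hf₀, hf₀0⟩ := key (q := k) (by positivity)
      obtain ⟨f₁, hm₁, hf₁, hf₁0⟩ := key (q := k + 1) (by positivity)
      obtain ⟨f₂, hm₂, hf₂, hf₂0⟩ := key (q := k + 2) (by positivity)
      convert! add_mem (sub_mem hm₂ ((convergenceSubmodule Gs).smul_mem 2 hm₁)) hm₀ using 1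
      refine eq_of_comp_expNeg (fun y => mul_right_cancel₀ (hw y) ?_) ?_
      · simp only [ContinuousMap.add_apply, ContinuousMap.sub_apply, ContinuousMap.smul_apply,
          smul_eq_mul, add_mul, sub_mul, mul_assoc, hf₀, hf₁, hf₂, ContinuousMap.mul_apply, hwe]
        rw [kernelTwo_second_difference]
        simp [← Real.exp_nat_mul, mul_assoc]
      · simp [hf₀0, hf₁0, hf₂0, hw0]
        ring
  refine exists_tendsto_pairing fun f => mem_convergenceSubmodule.1 ?_
  rw [htop]
  trivial

end ExtLevyMeasure


/-! ### Distribution functions, tails and cutoffs -/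

/-- The continuous piecewise linear function equal to `1` on `[0, a]` and to `0` on `[b, ∞)`. -/
def cutoff (a b y : ℝ≥0) : ℝ := max 0 (min 1 (((b : ℝ) - y) / (b - a)))

theorem continuous_cutoff (a b : ℝ≥0) : Continuous (cutoff a b) := by
  unfold cutoff; fun_prop

theorem cutoff_nonneg (a b y : ℝ≥0) : 0 ≤ cutoff a b y := le_max_left _ _

theorem cutoff_le_one (a b y : ℝ≥0) : cutoff a b y ≤ 1 := max_le zero_le_one (min_le_left _ _)

theorem cutoff_of_le {a b y : ℝ≥0} (hab : a < b) (h : y ≤ a) : cutoff a b y = 1 := by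
  have hab : (a : ℝ) < b := hab
  have h : (y : ℝ) ≤ a := h
  have : 1 ≤ ((b : ℝ) - y) / (b - a) := by rw [one_le_div] <;> linarith
  simp [cutoff, this]

theorem cutoff_of_ge {a b y : ℝ≥0} (hab : a < b) (h : b ≤ y) : cutoff a b y = 0 := by
  have hab : (a : ℝ) < b := hab
  have h : (b : ℝ) ≤ y := h
  have : ((b : ℝ) - y) / (b - a) ≤ 0 := div_nonpos_of_nonpos_of_nonneg (by linarith) (by linarith)
  simp [cutoff, this]

/-- Monotone functions have countably many discontinuities, and an interval is uncountable. -/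
theorem exists_continuousAt_of_monotone {f g : ℝ≥0 → ℝ} (hf : Monotone f) (hg : Monotone g)
    {x z : ℝ≥0} (hxz : x < z) : ∃ y ∈ Ioo x z, ContinuousAt f y ∧ ContinuousAt g y := by
  by_contra! h
  have hc : (Ioo x z).Countable := by
    refine (hf.countable_not_continuousAt.union hg.countable_not_continuousAt).mono fun y hy => ?_
    by_cases hfy : ContinuousAt f y
    · exact Or.inr (h y hy hfy)
    · exact Or.inl hfy
  have hsub : Ioo (x : ℝ) z ⊆ NNReal.toReal '' Ioo x z := fun y hy =>
    ⟨⟨y, x.coe_nonneg.trans hy.1.le⟩, ⟨hy.1, hy.2⟩, rfl⟩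
  have h2 := Cardinal.Real.Ioo_countable_iff.1 ((hc.image _).mono hsub)
  exact absurd hxz (not_lt.2 (by exact_mod_cast h2))

/-- Sandwiches on `(a, x)` and `(x, b)` bound `D n x` from below and above. Monotonicity of `D₀` is
not assumed: the sandwiches supply it. -/
theorem tendsto_of_interlacing {D : ℕ → ℝ≥0 → ℝ} {D₀ : ℝ≥0 → ℝ} {x : ℝ≥0}
    (h : ∀ a b, 0 < a → a < b → ∃ (c : ℕ → ℝ) (l : ℝ), Tendsto c atTop (𝓝 l) ∧
      (∀ n, D n a ≤ c n ∧ c n ≤ D n b) ∧ D₀ a ≤ l ∧ l ≤ D₀ b)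
    (hx : ∀ ε > 0, ∃ a b, 0 < a ∧ a < x ∧ x < b ∧ D₀ b < D₀ a + ε) :
    Tendsto (fun n => D n x) atTop (𝓝 (D₀ x)) := by
  rw [Metric.tendsto_nhds]
  intro ε hε
  obtain ⟨a, b, ha, hax, hxb, hab⟩ := hx ε hε
  obtain ⟨c, l, hc, hn, h1, h2⟩ := h a x ha hax
  obtain ⟨c', l', hc', hn', h1', h2'⟩ := h x b (ha.trans hax) hxb
  filter_upwards [hc.eventually_const_lt (show D₀ x - ε < l by linarith),
    hc'.eventually_lt_const (show l' < D₀ x + ε by linarith)] with n h3 h4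
  rw [Real.dist_eq, abs_lt]
  constructor <;> linarith [(hn n).2, (hn' n).1]

namespace ExtLevyMeasure

theorem measure_Icc_lt_top (G : ExtLevyMeasure) (x : ℝ≥0) : G.toMeasure (Icc 0 x) < ∞ := by
  have hc : min 1 (x : ℝ≥0∞)⁻¹ ≠ 0 := by simp
  refine lt_of_le_of_lt (measure_mono ?_) ((meas_ge_le_lintegral_div
    (f := fun y : ℝ≥0 => min 1 (y : ℝ≥0∞)⁻¹) (by fun_prop) hc (by simp)).trans_lt
      (ENNReal.div_lt_top G.isLevy.ne hc))
  intro y hy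
  exact min_le_min_left _ (ENNReal.inv_le_inv.2 (by exact_mod_cast hy.2))

theorem integrable_indicator_Icc (G : ExtLevyMeasure) (x : ℝ≥0) :
    Integrable ((Icc 0 x).indicator (1 : ℝ≥0 → ℝ)) G.toMeasure :=
  (integrableOn_const (G.measure_Icc_lt_top x).ne).integrable_indicator measurableSet_Icc

theorem distrib_eq_integral (G : ExtLevyMeasure) (x : ℝ≥0) :
    G.distrib x = ∫ y, (Icc 0 x).indicator (1 : ℝ≥0 → ℝ) y ∂G.toMeasure := by
  rw [integral_indicator_one measurableSet_Icc, distrib, measureReal_def]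

theorem monotone_distrib (G : ExtLevyMeasure) : Monotone G.distrib := fun _ b h =>
  ENNReal.toReal_mono (G.measure_Icc_lt_top b).ne (measure_mono (Icc_subset_Icc_right h))

theorem exists_continuousMap_distrib {a b : ℝ≥0} (hab : a < b) :
    ∃ f : C(unitInterval, ℝ), ∀ G : ExtLevyMeasure,
      G.distrib a ≤ G.pairing f ∧ G.pairing f ≤ G.distrib b := by
  have hlim : Tendsto (fun y : ℝ≥0 => y * cutoff a b y) atTop (𝓝 0) := by
    refine tendsto_const_nhds.congr' ?_
    filter_upwards [eventually_ge_atTop b] with y hy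
    rw [cutoff_of_ge hab hy, mul_zero]
  obtain ⟨f, hf, hf0⟩ := exists_mul_kernelOne_eq (continuous_cutoff a b) hlim
  refine ⟨f, fun G => ?_⟩
  have hint := G.integrable_mul_kernelOne f
  simp only [pairing_apply, hf, hf0, mul_zero, add_zero, distrib_eq_integral] at hint ⊢
  constructor
  · refine integral_mono (G.integrable_indicator_Icc a) hint fun y => ?_
    refine indicator_le' (fun y hy => ?_) (fun y _ => cutoff_nonneg a b y) y
    rw [cutoff_of_le hab hy.2, Pi.one_apply]
  · refine integral_mono hint (G.integrable_indicator_Icc b) fun y => ?_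
    by_cases hy : y ≤ b
    · simpa [hy] using cutoff_le_one a b y
    · simp [hy, cutoff_of_ge hab (not_le.1 hy).le]

theorem exists_continuousMap_tail {a b : ℝ≥0} (ha : 0 < a) (hab : a < b) :
    ∃ f : C(unitInterval, ℝ), f 0 = 1 ∧ ∀ y : ℝ≥0,
      (Ici b).indicator (fun y : ℝ≥0 => (y : ℝ)⁻¹) y ≤ f (expNeg y) * kernelOne 1 y ∧
      f (expNeg y) * kernelOne 1 y ≤ (Ici a).indicator (fun y : ℝ≥0 => (y : ℝ)⁻¹) y := by
  have ha' : 0 < (a : ℝ) := ha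
  have hm (y : ℝ≥0) : 0 < max (y : ℝ) a := lt_max_of_lt_right ha'
  -- The `max` avoids dividing by zero and changes nothing, as the numerator vanishes for `y ≤ a`.
  have hcont : Continuous fun y : ℝ≥0 => (1 - cutoff a b y) / max (y : ℝ) a :=
    (continuous_const.sub (continuous_cutoff a b)).div (by fun_prop) fun y => (hm y).ne'
  have hlim : Tendsto (fun y : ℝ≥0 => y * ((1 - cutoff a b y) / max (y : ℝ) a)) atTop (𝓝 1) := by
    refine tendsto_const_nhds.congr' ?_
    filter_upwards [eventually_ge_atTop b] with y hy
    have hay : (a : ℝ) ≤ y := hab.le.trans hy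
    rw [cutoff_of_ge hab hy, sub_zero, max_eq_left hay, mul_one_div_cancel (ha'.trans_le hay).ne']
  obtain ⟨f, hf, hf0⟩ := exists_mul_kernelOne_eq hcont hlim
  refine ⟨f, hf0, fun y => ?_⟩
  rw [hf]
  have h0 : 0 ≤ (1 - cutoff a b y) / max (y : ℝ) a :=
    div_nonneg (sub_nonneg.2 (cutoff_le_one a b y)) (hm y).le
  constructor
  · by_cases hy : b ≤ y
    · have hay : (a : ℝ) ≤ y := hab.le.trans hy
      simp [hy, cutoff_of_ge hab hy, max_eq_left hay]
    · simpa [hy] using h0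
  · by_cases hy : a ≤ y
    · have hay : (a : ℝ) ≤ y := hy
      have hy0 : 0 < (y : ℝ) := ha'.trans_le hay
      simp only [mem_Ici, hy, indicator_of_mem, max_eq_left hay]
      rw [← one_div]
      gcongr
      linarith [cutoff_nonneg a b y]
    · simp [hy, cutoff_of_le hab (not_le.1 hy).le]

theorem integrable_indicator_Ici (G : ExtLevyMeasure) {x : ℝ≥0} (hx : 0 < x) :
    Integrable ((Ici x).indicator fun y : ℝ≥0 => (y : ℝ)⁻¹) G.toMeasure := by
  obtain ⟨f, -, hf⟩ := exists_continuousMap_tail (half_pos hx) (half_lt_self hx)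
  refine (G.integrable_mul_kernelOne f).mono' ?_ (Eventually.of_forall fun y => ?_)
  · exact (Measurable.indicator (by fun_prop) measurableSet_Ici).aestronglyMeasurable
  · rw [Real.norm_of_nonneg (indicator_nonneg (fun y _ => by positivity) y)]
    exact (hf y).1

theorem tail_eq_integral (G : ExtLevyMeasure) (x : ℝ≥0) :
    G.tail x = (∫ y, (Ici x).indicator (fun y : ℝ≥0 => (y : ℝ)⁻¹) y ∂G.toMeasure) + G.charge := by
  rw [integral_indicator measurableSet_Ici, tail]

theorem tail_le_pairing_le_tail (G : ExtLevyMeasure) {a b : ℝ≥0} (ha : 0 < a) (hab : a < b)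
    {f : C(unitInterval, ℝ)} (hf0 : f 0 = 1)
    (hf : ∀ y : ℝ≥0,
      (Ici b).indicator (fun y : ℝ≥0 => (y : ℝ)⁻¹) y ≤ f (expNeg y) * kernelOne 1 y ∧
      f (expNeg y) * kernelOne 1 y ≤ (Ici a).indicator (fun y : ℝ≥0 => (y : ℝ)⁻¹) y) :
    G.tail b ≤ G.pairing f ∧ G.pairing f ≤ G.tail a := by
  rw [tail_eq_integral, tail_eq_integral, pairing_apply, hf0, mul_one]
  constructor <;> gcongr
  · exact G.integrable_indicator_Ici (ha.trans hab)
  · exact G.integrable_mul_kernelOne f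
  · exact fun y => (hf y).1
  · exact G.integrable_mul_kernelOne f
  · exact G.integrable_indicator_Ici ha
  · exact fun y => (hf y).2

/-- On `[a, b)` one has `y⁻¹ ≤ a⁻¹`. The extra point `a' < a` makes `(a', b]` include a possible
atom at `a`. Thus continuity of `distrib` controls the tails. -/
theorem tail_sub_tail_le (G : ExtLevyMeasure) {a' a b : ℝ≥0} (ha : 0 < a) (h : a' < a)
    (hab : a < b) : G.tail a - G.tail b ≤ (a : ℝ)⁻¹ * (G.distrib b - G.distrib a') := by
  have h1 := G.integrable_indicator_Ici ha
  have h2 := G.integrable_indicator_Ici (ha.trans hab)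
  have h3 := G.integrable_indicator_Icc b
  have h4 := G.integrable_indicator_Icc a'
  rw [tail_eq_integral, tail_eq_integral, distrib_eq_integral, distrib_eq_integral,
    add_sub_add_right_eq_sub, ← integral_sub h1 h2, ← integral_sub h3 h4, ← integral_const_mul]
  refine integral_mono (h1.sub h2) ((h3.sub h4).const_mul _) fun y => ?_
  have ha0 : (0 : ℝ) < a := ha
  by_cases hy : a ≤ y
  · have hy' : ¬ y ≤ a' := not_le.2 (h.trans_le hy)
    by_cases hyb : b ≤ y
    · by_cases hyb' : y ≤ b <;> simp [hy, hy', hyb, hyb']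
    · have hinv : (y : ℝ)⁻¹ ≤ (a : ℝ)⁻¹ := inv_anti₀ ha0 hy
      simpa [hy, hy', hyb, (not_le.1 hyb).le] using hinv
  · have hyb : ¬ b ≤ y := not_le.2 ((not_le.1 hy).trans hab)
    by_cases hy' : y ≤ a' <;> simp [hy, hy', hyb, (not_le.1 hyb).le]

theorem exists_distrib_lt {G : ExtLevyMeasure} {x : ℝ≥0} (hx : 0 < x)
    (hG : ContinuousAt G.distrib x) {ε : ℝ} (hε : 0 < ε) :
    ∃ a b, x / 2 < a ∧ a < x ∧ x < b ∧ G.distrib b < G.distrib a + ε := by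
  have h : ∀ᶠ y in 𝓝 x, dist (G.distrib y) (G.distrib x) < ε / 2 :=
    (Metric.tendsto_nhds.1 hG) _ (half_pos hε)
  have h2 : ∀ᶠ y in 𝓝 x, x / 2 < y := lt_mem_nhds (half_lt_self hx)
  have : (𝓝[<] x).NeBot := nhdsLT_neBot_of_exists_lt ⟨0, hx⟩
  obtain ⟨a, ⟨ha, ha2⟩, hax⟩ :=
    (((h.and h2).filter_mono nhdsWithin_le_nhds).and (self_mem_nhdsWithin (s := Iio x))).exists
  obtain ⟨b, hb, hxb⟩ :=
    ((h.filter_mono nhdsWithin_le_nhds).and (self_mem_nhdsWithin (s := Ioi x))).exists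
  rw [Real.dist_eq, abs_lt] at ha hb
  exact ⟨a, b, ha2, hax, hxb, by linarith⟩

/-! ### Equivalence of `ConvergesTo` with convergence of functionals -/

theorem convergesTo_of_tendsto_pairing {Gs : ℕ → ExtLevyMeasure} {G : ExtLevyMeasure}
    (h : ∀ f, Tendsto (fun n => (Gs n).pairing f) atTop (𝓝 (G.pairing f))) :
    ConvergesTo Gs G := by
  intro x hx hG
  constructor
  · refine tendsto_of_interlacing (D := fun n => (Gs n).distrib) (fun a b _ hab => ?_)
      fun ε hε => ?_
    · obtain ⟨f, hf⟩ := exists_continuousMap_distrib hab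
      exact ⟨_, _, h f, fun n => hf _, hf G⟩
    · obtain ⟨a, b, ha, hax, hxb, hab⟩ := exists_distrib_lt hx hG hε
      exact ⟨a, b, (half_pos hx).trans ha, hax, hxb, hab⟩
  · suffices Tendsto (fun n => -(Gs n).tail x) atTop (𝓝 (-G.tail x)) by simpa using this.neg
    -- Tails decrease in `x`; the sign makes them increasing.
    refine tendsto_of_interlacing (D := fun n x => -(Gs n).tail x) (D₀ := fun x => -G.tail x)
      (fun a b ha hab => ?_) fun ε hε => ?_
    · obtain ⟨f, hf0, hf⟩ := exists_continuousMap_tail ha hab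
      have hf (G : ExtLevyMeasure) := G.tail_le_pairing_le_tail ha hab hf0 hf
      exact ⟨_, _, (h f).neg, fun n => ⟨neg_le_neg (hf _).2, neg_le_neg (hf _).1⟩,
        neg_le_neg (hf G).2, neg_le_neg (hf G).1⟩
    · have hx' : (0 : ℝ) < x := hx
      -- The factor `x / 2` offsets `a⁻¹ < 2 / x`.
      obtain ⟨a', b, ha', hax, hxb, hab⟩ := exists_distrib_lt hx hG (ε := x / 2 * ε) (by positivity)
      obtain ⟨a, haa, hax⟩ := exists_between hax
      have ha0 : 0 < a := (half_pos hx).trans (ha'.trans haa)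
      refine ⟨a, b, ha0, hax, hxb, ?_⟩
      have h1 := G.tail_sub_tail_le ha0 haa (hax.trans hxb)
      have ha0' : (0 : ℝ) < a := ha0
      have h2 : (x : ℝ) / 2 < a := by exact_mod_cast ha'.trans haa
      have h3 : (a : ℝ)⁻¹ * (G.distrib b - G.distrib a') < ε := by
        rw [inv_mul_lt_iff₀ ha0']
        nlinarith
      linarith

/-- The distribution functions agree at common continuity points, which are dense, hence everywhere
by right continuity. -/
theorem toMeasure_eq_of_convergesTo {Gs : ℕ → ExtLevyMeasure} {G G' : ExtLevyMeasure}
    (h : ConvergesTo Gs G) (h' : ConvergesTo Gs G') : G.toMeasure = G'.toMeasure := by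
  have hlim (G : ExtLevyMeasure) (x : ℝ≥0) :
      Tendsto (fun r => G.toMeasure (Icc 0 r)) (𝓝[>] x) (𝓝 (G.toMeasure (Icc 0 x))) := by
    have := tendsto_measure_biInter_gt (μ := G.toMeasure) (s := fun r => Icc 0 r) (a := x)
      (fun r _ => measurableSet_Icc.nullMeasurableSet) (fun i j _ hij => Icc_subset_Icc_right hij)
      ⟨x + 1, by simp, (G.measure_Icc_lt_top _).ne⟩
    convert! this using 3
    ext y
    simp only [mem_Icc, zero_le, true_and, mem_iInter]
    exact ⟨fun h r hr => h.trans hr.le, fun h => le_of_forall_gt_imp_ge_of_dense h⟩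
  have heq (x : ℝ≥0) : G.toMeasure (Icc 0 x) = G'.toMeasure (Icc 0 x) := by
    refine tendsto_nhds_unique_of_frequently_eq (hlim G x) (hlim G' x) ?_
    rw [frequently_iff]
    intro U hU
    obtain ⟨z, hz, hzU⟩ := (mem_nhdsGT_iff_exists_Ioo_subset' (lt_add_one x)).1 hU
    obtain ⟨y, hy, hc, hc'⟩ := exists_continuousAt_of_monotone G.monotone_distrib
      G'.monotone_distrib hz
    have hy0 : 0 < y := (zero_le (a := x)).trans_lt hy.1
    refine ⟨y, hzU hy, ?_⟩
    rw [← ENNReal.toReal_eq_toReal_iff' (G.measure_Icc_lt_top _).ne (G'.measure_Icc_lt_top _).ne]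
    exact tendsto_nhds_unique (h y hy0 hc).1 (h' y hy0 hc').1
  have hIic (x : ℝ≥0) : Icc 0 x = Iic x := by ext; simp
  refine Measure.ext_of_generateFrom_of_iUnion (range Iic) (fun n : ℕ => Iic (n : ℝ≥0))
    (borel_eq_generateFrom_Iic ℝ≥0 ▸ BorelSpace.measurable_eq) isPiSystem_Iic ?_
    (fun n => mem_range_self _) (fun n => ?_) ?_
  · exact eq_univ_of_forall fun y => mem_iUnion.2 (exists_nat_ge y)
  · rw [← hIic]
    exact (G.measure_Icc_lt_top _).ne
  · rintro _ ⟨x, rfl⟩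
    rw [← hIic, heq]

theorem eq_of_convergesTo {Gs : ℕ → ExtLevyMeasure} {G G' : ExtLevyMeasure}
    (h : ConvergesTo Gs G) (h' : ConvergesTo Gs G') : G = G' := by
  have hm := toMeasure_eq_of_convergesTo h h'
  obtain ⟨y, hy, hc, hc'⟩ := exists_continuousAt_of_monotone G.monotone_distrib
    G'.monotone_distrib (zero_lt_one' ℝ≥0)
  have ht := tendsto_nhds_unique (h y hy.1 hc).2 (h' y hy.1 hc').2
  -- With equal measures, a single tail limit determines the charge.
  cases G
  cases G'
  simp only [tail] at hm ht
  subst hm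
  simpa using ht

theorem pairing_one_le (G : ExtLevyMeasure) {x : ℝ≥0} (hx : 0 < x) :
    G.pairing 1 ≤ G.distrib x + G.tail x := by
  rw [pairing_apply, distrib_eq_integral, tail_eq_integral, ← add_assoc,
    ← integral_add (G.integrable_indicator_Icc x) (G.integrable_indicator_Ici hx)]
  simp only [ContinuousMap.one_apply, one_mul, mul_one]
  gcongr
  · exact G.integrable_kernelOne_one
  · exact (G.integrable_indicator_Icc x).add (G.integrable_indicator_Ici hx)
  · intro y
    by_cases hy : x ≤ y
    · have h0 : (0 : ℝ) < y := hx.trans_le hy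
      have := kernelOne_one_le_inv h0
      have h1 : 0 ≤ (Icc 0 x).indicator (1 : ℝ≥0 → ℝ) y := indicator_nonneg (fun _ _ => by simp) y
      simp only [mem_Ici, hy, indicator_of_mem]
      linarith
    · simpa [hy, (not_le.1 hy).le] using kernelOne_one_le_one y.coe_nonneg

theorem tendsto_pairing_of_convergesTo {Gs : ℕ → ExtLevyMeasure} {G : ExtLevyMeasure}
    (h : ConvergesTo Gs G) (f : C(unitInterval, ℝ)) :
    Tendsto (fun n => (Gs n).pairing f) atTop (𝓝 (G.pairing f)) := by
  obtain ⟨x, hx, hc, -⟩ := exists_continuousAt_of_monotone G.monotone_distrib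
    G.monotone_distrib (zero_lt_one' ℝ≥0)
  obtain ⟨C, hC⟩ := ((h x hx.1 hc).1.add (h x hx.1 hc).2).bddAbove_range
  have hC' (n) : (Gs n).pairing 1 ≤ C := ((Gs n).pairing_one_le hx.1).trans (hC ⟨n, rfl⟩)
  refine tendsto_of_subseq_tendsto fun ns hns => ?_
  -- All moments lie in `[0, C]`, so by Tychonoff a subsequence has every moment convergent; its
  -- limit must be `G` by uniqueness.
  have hmem (n : ℕ) : (fun k => (Gs (ns n)).pairing (monomialMap k)) ∈
      Set.pi univ fun _ : ℕ => Icc (0 : ℝ) C := by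
    refine fun k _ => ⟨(Gs _).pairing_nonneg fun u => pow_nonneg u.2.1 k,
      ((Gs _).pairing_mono fun u => ?_).trans (hC' _)⟩
    exact pow_le_one₀ u.2.1 u.2.2
  obtain ⟨m, -, ms, hms, hlim⟩ :=
    (isCompact_univ_pi fun _ : ℕ => isCompact_Icc (a := (0 : ℝ)) (b := C)).tendsto_subseq hmem
  obtain ⟨G', hG'⟩ := exists_tendsto_pairing_of_monomialMap (Gs := fun n => Gs (ns (ms n)))
    fun k => ⟨m k, tendsto_pi_nhds.1 hlim k⟩
  have hsub : ConvergesTo (fun n => Gs (ns (ms n))) G := fun y hy hyc =>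
    ⟨(h y hy hyc).1.comp (hns.comp hms.tendsto_atTop),
      (h y hy hyc).2.comp (hns.comp hms.tendsto_atTop)⟩
  exact ⟨ms, eq_of_convergesTo (convergesTo_of_tendsto_pairing hG') hsub ▸ hG' f⟩

theorem ConvergesTo.tendsto_laplaceOne {Gs : ℕ → ExtLevyMeasure} {G : ExtLevyMeasure}
    (h : ConvergesTo Gs G) {q : ℝ} (hq : 0 < q) :
    Tendsto (fun n => (Gs n).laplaceOne q) atTop (𝓝 (G.laplaceOne q)) := by
  obtain ⟨f, hf, hf0⟩ := exists_mul_kernelOne_eq_kernelOne hq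
  simp only [laplaceOne_eq_pairing hq hf hf0]
  exact (Complex.continuous_ofReal.tendsto _).comp (tendsto_pairing_of_convergesTo h f)

theorem ConvergesTo.tendsto_laplaceTwo {Gs : ℕ → ExtLevyMeasure} {G : ExtLevyMeasure}
    (h : ConvergesTo Gs G) {q : ℝ} (hq : 0 < q) :
    Tendsto (fun n => (Gs n).laplaceTwo q) atTop (𝓝 (G.laplaceTwo q)) := by
  obtain ⟨f, hf, hf0⟩ := exists_mul_kernelOne_eq_kernelTwo hq
  simp only [laplaceTwo_eq_pairing hq hf hf0]
  exact (Complex.continuous_ofReal.tendsto _).comp (tendsto_pairing_of_convergesTo h f)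

end ExtLevyMeasure

end

theorem theorem3p1 (Gs : ℕ → ExtLevyMeasure) :
    List.TFAE [
      ∃ G : ExtLevyMeasure, ExtLevyMeasure.ConvergesTo Gs G,
      ∀ q : ℝ, 0 < q → ∃ l : ℂ,
        Tendsto (fun n => (Gs n).laplaceOne (q : ℂ)) atTop (𝓝 l),
      ∀ q : ℝ, 0 < q → ∃ l : ℂ,
        Tendsto (fun n => (Gs n).laplaceTwo (q : ℂ)) atTop (𝓝 l)] ∧
    ∀ G : ExtLevyMeasure, ExtLevyMeasure.ConvergesTo Gs G →
      ∀ q : ℝ, 0 < q →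
        Tendsto (fun n => (Gs n).laplaceOne (q : ℂ)) atTop (𝓝 (G.laplaceOne (q : ℂ))) ∧
        Tendsto (fun n => (Gs n).laplaceTwo (q : ℂ)) atTop (𝓝 (G.laplaceTwo (q : ℂ))) := by
  refine ⟨?_, fun G h q hq => ⟨h.tendsto_laplaceOne hq, h.tendsto_laplaceTwo hq⟩⟩
  tfae_have 1 → 2 := fun ⟨_, h⟩ _ hq => ⟨_, h.tendsto_laplaceOne hq⟩
  tfae_have 1 → 3 := fun ⟨_, h⟩ _ hq => ⟨_, h.tendsto_laplaceTwo hq⟩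
  tfae_have 2 → 1 := fun h =>
    let ⟨G, hG⟩ := ExtLevyMeasure.exists_tendsto_pairing_of_laplaceOne h
    ⟨G, ExtLevyMeasure.convergesTo_of_tendsto_pairing hG⟩
  tfae_have 3 → 1 := fun h =>
    let ⟨G, hG⟩ := ExtLevyMeasure.exists_tendsto_pairing_of_laplaceTwo h
    ⟨G, ExtLevyMeasure.convergesTo_of_tendsto_pairing hG⟩
  tfae_finish
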